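/- **Theorem (privacy of the tree mechanism).** Let $n\in\mathbb N$ with $n=3$ or $n\ge 5$, and let $\mathcal X=\mathbb R^d$ with the Euclidean norm. For $i\in[n]=\{1,\dots,n\}$ let $\mathcal Z^{(i)}$ be the set of datasets consisting of $m_i$ data points of some data domain $\mathcal D_i$, and let $\mathcal Z^{(1:n)}=\mathcal Z^{(1)}\times\dots\times\mathcal Z^{(n)}$. Two datasets $Z_{1:n},Z'_{1:n}\in\mathcal Z^{(1:n)}$ are *neighboring* if they differ in exactly one data point. Let $\mathcal M^{(i)}:\mathcal X^{i-1}\times\mathcal Z^{(i)}\to\mathcal X$, $i\in[n]$, be a sequence of algorithms, which may also use internal randomness $\omega$, a random element of a probability space. We write $\mathcal M^{(i)}(x_{1:i-1},Z_i)=\mathcal M^{(i)}(x_{1:i-1},Z_i;\omega)$, and assume this is jointly measurable in $(x_{1:i-1},\omega)$; the deterministic case is the one where it does not depend on $\omega$. For $t\ge 1$ let $\mathrm{Node}(t)$ be the set of intervals produced as follows: start with $k=0$, and for $i=0,1,\dots,\lceil\log_2 t\rceil$ in this order put $k'=k+2^{\lceil\log_2 t\rceil-i}$; if $k'\le t$,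 add $(k+1,k')$ to the set and replace $k$ by $k'$. (For example $\mathrm{Node}(7)=\{(1,4),(5,6),(7,7)\}$.) Let $\sigma_1,\dots,\sigma_n>0$, let $\xi_b\sim N(0,\sigma_b^2 I)$, $b\in[n]$, be independent of each other and of $\omega$, and let $$\mathrm{Tree}(i)=\sum_{(a,b)\in\mathrm{Node}(i)}\xi_b .$$ Let $\mathcal A$ be the randomized algorithm that, given $Z_{1:n}\in\mathcal Z^{(1:n)}$, sequentially computes $$x_i=\sum_{j=1}^i\mathcal M^{(j)}(x_{1:j-1},Z_j)+\mathrm{Tree}(i),\qquad i=1,\dots,n,$$ where each $\mathcal M^{(j)}(x_{1:j-1},Z_j)$ is evaluated once, and outputs $x_{1:n}\in\mathcal X^n$. Suppose that $s_1,\dots,s_n\ge 0$ are such that for all $i\in[n]$ and all neighboring $Z_{1:n},Z_{1:n}'$, $$\|\mathcal M^{(i)}(x_{1:i-1},Z_i)-\mathcal M^{(i)}(x_{1:i-1},Z_i')\|\le s_i$$ for all auxiliary inputs $x_{1:i-1}\in\mathcal X^{i-1}$ (and every value of the internal randomness $\omega$, the same on both sides). Then there is a number $\rho\ge 0$ with $$\rho\le\sqrt{2\ln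 n}\cdot\max_{b\in[n],\,i\le b}\frac{s_i}{\sigma_b}$$ such that for every $\alpha>1$ the algorithm $\mathcal A$ is $(\alpha,\alpha\rho^2/2)$-RDP, that is, $D_\alpha\big(\mathcal A(Z_{1:n})\,\|\,\mathcal A(Z'_{1:n})\big)\le\alpha\rho^2/2$ for all neighboring $Z_{1:n},Z'_{1:n}$. Here $D_\alpha(\mu\|\nu)=\frac1{\alpha-1}\ln\int\big(\frac{d\mu}{d\nu}\big)^\alpha d\nu$ if $\mu\ll\nu$, and $D_\alpha(\mu\|\nu)=\infty$ otherwise, is the Rényi divergence of the output distributions. -/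

import Mathlib

open MeasureTheory ProbabilityTheory

noncomputable section

/-! ### Rényi divergence and Rényi differential privacy -/

open Classical in
/-- The Rényi divergence of order `α > 1` of (probability) measures `μ`, `ν`:
`D_α(μ‖ν) = (α - 1)⁻¹ log ∫ (dμ/dν)^α dν` if `μ ≪ ν`, and `+∞` otherwise. -/
def renyiDiv {X : Type*} [MeasurableSpace X] (α : ℝ) (μ ν : Measure X) : EReal :=
  if μ ≪ ν then (((α - 1)⁻¹ : ℝ) : EReal) * ENNReal.log (∫⁻ x, (μ.rnDeriv ν x) ^ α ∂ν) else ⊤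

/-- A randomized algorithm, given by its output law `A Z` on each dataset `Z`, is
`(α, ε)`-RDP for the neighboring relation `Nbr` if `D_α(A Z‖A Z') ≤ ε` for all neighboring
`Z`, `Z'`. -/
def IsRDP {𝒵 X : Type*} [MeasurableSpace X] (Nbr : 𝒵 → 𝒵 → Prop) (A : 𝒵 → Measure X)
    (α ε : ℝ) : Prop :=
  ∀ Z Z' : 𝒵, Nbr Z Z' → renyiDiv α (A Z) (A Z') ≤ (ε : EReal)

/-! ### Datasets -/

/-- The full dataset `Z_{1:n}`: its `i`-th part consists of `m i` data points from `D i`. -/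
abbrev FullDataset {n : ℕ} (m : Fin n → ℕ) (D : Fin n → Type*) : Type _ :=
  (i : Fin n) → Fin (m i) → D i

/-- Two datasets are neighboring if they differ in exactly one data point. -/
def Neighboring {n : ℕ} {m : Fin n → ℕ} {D : Fin n → Type*} (Z Z' : FullDataset m D) : Prop :=
  ∃! p : (i : Fin n) × Fin (m i), Z p.1 p.2 ≠ Z' p.1 p.2

/-! ### The tree mechanism -/

/-- The function `NODE(t)`. Starting from `k = 0` and `S = ∅`, for `i = 0, …, ⌈log₂ t⌉` in this
order, put `k' = k + 2^(⌈log₂ t⌉ - i)`; if `k' ≤ t`, add the node `(k + 1, k')` to `S` and set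
`k` to `k'`. (When `k = t` the test `k' ≤ t` fails, so the loop adds nothing any more.) -/
def treeNode (t : ℕ) : Finset (ℕ × ℕ) :=
  ((List.range (Nat.clog 2 t + 1)).foldl
    (fun (kS : ℕ × Finset (ℕ × ℕ)) (i : ℕ) =>
      if kS.1 + 2 ^ (Nat.clog 2 t - i) ≤ t then
        (kS.1 + 2 ^ (Nat.clog 2 t - i),
          insert (kS.1 + 1, kS.1 + 2 ^ (Nat.clog 2 t - i)) kS.2)
      else kS)
    (0, ∅)).2

open Classical in
/-- The noise `TREE(i) = ∑_{(·, b) ∈ NODE(i)} ξ_b`. Steps are numbered `1, …, n` in the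
mechanism, and step `b` is the element `b - 1` of `Fin n`. -/
def treeNoise {n d : ℕ} (ξ : Fin n → EuclideanSpace ℝ (Fin d)) (i : Fin n) :
    EuclideanSpace ℝ (Fin d) :=
  ∑ b ∈ Finset.univ.filter
    (fun b : Fin n => ∃ a : ℕ, (a, (b : ℕ) + 1) ∈ treeNode ((i : ℕ) + 1)), ξ b

/-- The outputs `x_i = ∑_{j ≤ i} M^{(j)}(x_{1:j-1}, Z_j) + TREE(i)`, computed sequentially, as a
function of the dataset `Z`, of the internal randomness `ω` of the algorithms `M^{(j)}`
(each of which is run once), and of the noise vectors `ξ`. -/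
def treeOutput {n d : ℕ} {m : Fin n → ℕ} {D : Fin n → Type*} {Ω : Type*}
    (M : (i : Fin n) → (Fin (i : ℕ) → EuclideanSpace ℝ (Fin d)) → (Fin (m i) → D i) → Ω →
      EuclideanSpace ℝ (Fin d))
    (Z : FullDataset m D) (ω : Ω) (ξ : Fin n → EuclideanSpace ℝ (Fin d)) (i : Fin n) :
    EuclideanSpace ℝ (Fin d) :=
  (∑ j : Fin ((i : ℕ) + 1),
    M ⟨j, by omega⟩ (fun k : Fin (j : ℕ) => treeOutput M Z ω ξ ⟨k, by omega⟩)
      (Z ⟨j, by omega⟩) ω)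
  + treeNoise ξ i
termination_by (i : ℕ)
decreasing_by
  have := k.isLt
  have := j.isLt
  omega

/-- The law of the noise `ξ_1, …, ξ_n`: independent, with `ξ_b ∼ N(0, σ_b² I)`. -/
def noiseLaw {n : ℕ} (d : ℕ) (σ : Fin n → ℝ) : Measure (Fin n → EuclideanSpace ℝ (Fin d)) :=
  Measure.pi fun b => multivariateGaussian 0 ((σ b) ^ 2 • (1 : Matrix (Fin d) (Fin d) ℝ))

/-- The algorithm `𝒜`: the law of `x_{1:n}` on the dataset `Z`, when the internal randomness of
the algorithms `M^{(i)}` has law `P` and is independent of the noise. -/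
def treeMechanism {n d : ℕ} {m : Fin n → ℕ} {D : Fin n → Type*} {Ω : Type*} [MeasurableSpace Ω]
    (P : Measure Ω)
    (M : (i : Fin n) → (Fin (i : ℕ) → EuclideanSpace ℝ (Fin d)) → (Fin (m i) → D i) → Ω →
      EuclideanSpace ℝ (Fin d))
    (σ : Fin n → ℝ) (Z : FullDataset m D) : Measure (Fin n → EuclideanSpace ℝ (Fin d)) :=
  (P.prod (noiseLaw d σ)).map fun p => treeOutput M Z p.1 p.2

end

/-! Couple the runs on `Z` and `Z'` by moving the noise. Each step `b` carries the block of steps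
`(b - 2^v, b]`, with `2^v` the exact power of two dividing `b`, and the blocks of the nodes used at
time `i` partition `1, …, i`. Shift `ξ_b` by the sum, over the block of `b`, of the differences
between the summands on `Z` and on `Z'`. Then the tree noise at time `i` changes by all the
differences up to `i`, so the run on `Z'` with shifted noise reproduces the run on `Z` with the
original noise (`treeOutput_add_noiseShift`).

It remains to compare the laws of `ξ + δ(ξ)` and `ξ`. The shift of `ξ_b` depends only on earlier
noise, so adaptive composition (`HolderDominated.pi_map_add`) adds up the Gaussian costs `(‖δ_b‖ /
σ_b)²`. Neighbors differ in a single part, so only blocks containing that step contribute; there are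
at most `⌊log₂ n⌋ + 1 ≤ 2 ln n` of them.

Rényi bounds are carried in dual form: images and composition then need only integration of test
functions, never the density of an adaptively shifted law. -/

open scoped ENNReal

/-! ### Duality for Rényi bounds, and adaptive composition -/

/-- `μ` is dominated by `ν` in the dual form of an `L^p` bound on the density `dμ/dν`, where `q` is
the exponent conjugate to `p`. -/
def HolderDominated {X : Type*} [MeasurableSpace X] (q : ℝ) (K : ℝ≥0∞) (μ ν : Measure X) : Prop :=
  ∀ φ : X → ℝ≥0∞, Measurable φ → ∫⁻ x, φ x ∂μ ≤ K * (∫⁻ x, φ x ^ q ∂ν) ^ (1 / q)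

namespace HolderDominated

variable {X Y : Type*} [MeasurableSpace X] [MeasurableSpace Y] {p q : ℝ} {K : ℝ≥0∞}
  {μ ν : Measure X}

theorem map (h : HolderDominated q K μ ν) {f : X → Y} (hf : Measurable f) :
    HolderDominated q K (μ.map f) (ν.map f) := by
  intro φ hφ
  rw [lintegral_map hφ hf, lintegral_map (hφ.pow_const q) hf]
  exact h _ (hφ.comp hf)

theorem mono (h : HolderDominated q K μ ν) {K' : ℝ≥0∞} (hK : K ≤ K') :
    HolderDominated q K' μ ν := fun φ hφ => (h φ hφ).trans (by gcongr)

theorem absolutelyContinuous (h : HolderDominated q K μ ν) (hq : 0 < q) : μ ≪ ν := by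
  refine Measure.AbsolutelyContinuous.mk fun s hs h0 => ?_
  have := h (s.indicator 1) (measurable_one.indicator hs)
  have e : (fun x => (s.indicator (1 : X → ℝ≥0∞) x) ^ q) = s.indicator 1 := by
    ext x
    by_cases hx : x ∈ s <;> simp [hx, hq]
  rw [e, lintegral_indicator_one hs, lintegral_indicator_one hs, h0,
    ENNReal.zero_rpow_of_pos (by positivity), mul_zero] at this
  exact le_antisymm this zero_le

/-- Test the domination on `f ^ (p - 1)`: since `(p - 1) q = p`, the integral `I` of `f ^ p`
satisfies `I ≤ K * I ^ (1 / q)`. Dividing requires `I` finite, hence the truncation at `N` and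
monotone convergence. -/
theorem lintegral_rnDeriv_rpow_le [IsFiniteMeasure μ] [IsFiniteMeasure ν]
    (h : HolderDominated q K μ ν) (hpq : p.HolderConjugate q) :
    ∫⁻ x, (μ.rnDeriv ν x) ^ p ∂ν ≤ K ^ p := by
  have hp := hpq.pos
  have hq := hpq.symm.pos
  have hac := h.absolutelyContinuous hq
  set f := μ.rnDeriv ν with hf
  have hfm : Measurable f := Measure.measurable_rnDeriv μ ν
  have key (N : ℕ) : ∫⁻ x, (min (f x) N) ^ p ∂ν ≤ K ^ p := by
    set g : X → ℝ≥0∞ := fun x => min (f x) N with hg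
    have hgm : Measurable g := hfm.min measurable_const
    set I := ∫⁻ x, g x ^ p ∂ν with hI
    have hIfin : I ≠ ∞ := by
      refine ((lintegral_mono (g := fun _ => (N : ℝ≥0∞) ^ p) fun x => ?_).trans_lt ?_).ne
      · exact ENNReal.rpow_le_rpow (min_le_right _ _) hp.le
      · rw [lintegral_const]
        exact ENNReal.mul_lt_top (ENNReal.rpow_lt_top_of_nonneg hp.le (by simp))
          (measure_lt_top _ _)
    have h1 : I ≤ ∫⁻ x, g x ^ (p - 1) ∂μ := by
      rw [← lintegral_rnDeriv_mul hac (hgm.pow_const _).aemeasurable]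
      refine lintegral_mono fun x => ?_
      calc g x ^ p = g x * g x ^ (p - 1) := by
            have := ENNReal.rpow_add_of_nonneg (x := g x) 1 (p - 1) (by norm_num)
              (by linarith [hpq.lt])
            rw [ENNReal.rpow_one] at this
            rw [← this]; congr 1; ring
        _ ≤ f x * g x ^ (p - 1) := by gcongr; exact min_le_left _ _
    have h2 := h _ (hgm.pow_const (p - 1))
    simp_rw [← ENNReal.rpow_mul, hpq.sub_one_mul_conj] at h2
    have h3 : I ≤ K * I ^ (1 / q) := h1.trans h2
    rcases eq_or_ne I 0 with h0 | h0
    · rw [h0]; exact zero_le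
    have h4 : I ^ (1 / p) ≤ K := by
      have e : I = I ^ (1 / p) * I ^ (1 / q) := by
        rw [← ENNReal.rpow_add _ _ h0 hIfin]
        simp [hpq.inv_add_inv_eq_one]
      have hne : I ^ (1 / q) ≠ 0 := by simp [ENNReal.rpow_eq_zero_iff, h0, hIfin]
      have hnt : I ^ (1 / q) ≠ ∞ := ENNReal.rpow_ne_top_of_nonneg (by positivity) hIfin
      refine (ENNReal.mul_le_mul_iff_left hne hnt).1 ?_
      rw [← e]; exact h3
    calc I = (I ^ (1 / p)) ^ p := by
          rw [← ENNReal.rpow_mul, one_div, inv_mul_cancel₀ hp.ne', ENNReal.rpow_one]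
      _ ≤ K ^ p := ENNReal.rpow_le_rpow h4 hp.le
  have hlim : ∫⁻ x, f x ^ p ∂ν = ⨆ N : ℕ, ∫⁻ x, (min (f x) N) ^ p ∂ν := by
    rw [← lintegral_iSup (fun N => (hfm.min measurable_const).pow_const _)]
    · refine lintegral_congr fun x => ?_
      have : f x = ⨆ N : ℕ, min (f x) (N : ℝ≥0∞) := by
        rw [← inf_iSup_eq, ENNReal.iSup_natCast]; simp
      conv_lhs => rw [this]
      exact (ENNReal.orderIsoRpow p hp).map_iSup _
    · intro a b hab x
      exact ENNReal.rpow_le_rpow (min_le_min_left _ (by exact_mod_cast hab)) hp.le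
  rw [hlim]
  exact iSup_le key

theorem renyiDiv_le [IsFiniteMeasure μ] [IsFiniteMeasure ν] {c : ℝ}
    (h : HolderDominated q (ENNReal.ofReal (Real.exp ((p - 1) * c))) μ ν)
    (hpq : p.HolderConjugate q) : renyiDiv p μ ν ≤ ((p * c : ℝ) : EReal) := by
  have hp1 : 0 < p - 1 := by linarith [hpq.lt]
  rw [renyiDiv, if_pos (h.absolutelyContinuous hpq.symm.pos)]
  have h1 := ENNReal.log_monotone (h.lintegral_rnDeriv_rpow_le hpq)
  rw [ENNReal.log_rpow, ENNReal.log_ofReal_of_pos (Real.exp_pos _), Real.log_exp,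
    ← EReal.coe_mul] at h1
  refine (mul_le_mul_of_nonneg_left h1 (EReal.coe_nonneg.2 (inv_nonneg.2 hp1.le))).trans_eq ?_
  rw [← EReal.coe_mul]
  congr 1
  field_simp

/-- Randomizing by a common parameter does not destroy the domination. -/
theorem prod_map {P : Measure Y} [IsProbabilityMeasure P] [SFinite ν]
    (hq : 1 ≤ q) {S : Y × X → X} (hS : Measurable S)
    (h : ∀ y, HolderDominated q K (ν.map fun x => S (y, x)) ν) :
    HolderDominated q K ((P.prod ν).map fun z => (z.1, S z)) (P.prod ν) := by
  have hq0 : 0 < q := by linarith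
  intro φ hφ
  have hm : Measurable fun z : Y × X => (z.1, S z) := by fun_prop
  rw [lintegral_map hφ hm, lintegral_prod (fun z => φ (z.1, S z)) (hφ.comp hm).aemeasurable,
    lintegral_prod _ (hφ.pow_const q).aemeasurable]
  have hin : Measurable fun y => ∫⁻ x, φ (y, x) ^ q ∂ν := (hφ.pow_const q).lintegral_prod_right'
  calc ∫⁻ y, ∫⁻ x, φ (y, S (y, x)) ∂ν ∂P
      ≤ ∫⁻ y, K * (∫⁻ x, φ (y, x) ^ q ∂ν) ^ (1 / q) ∂P := by
        refine lintegral_mono fun y => ?_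
        have := h y (fun x => φ (y, x)) (by fun_prop)
        rwa [lintegral_map (by fun_prop) (by fun_prop)] at this
    _ = K * ∫⁻ y, (∫⁻ x, φ (y, x) ^ q ∂ν) ^ (1 / q) ∂P :=
        lintegral_const_mul _ (hin.pow_const _)
    _ ≤ K * (∫⁻ y, ∫⁻ x, φ (y, x) ^ q ∂ν ∂P) ^ (1 / q) := by
        gcongr
        -- Jensen for the concave power `1 / q`, obtained from Hölder against the constant 1; the
        -- conjugate exponent exists only for `q > 1`.
        rcases hq.eq_or_lt with rfl | hq1
        · simp
        have hc := Real.HolderConjugate.conjExponent hq1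
        have := ENNReal.lintegral_mul_le_Lp_mul_Lq P hc
          (f := fun y => (∫⁻ x, φ (y, x) ^ q ∂ν) ^ (1 / q)) (g := 1)
          (hin.pow_const _).aemeasurable aemeasurable_one
        simpa [← ENNReal.rpow_mul, inv_mul_cancel₀ hq0.ne'] using this

/-- Adaptive composition: coordinatewise shifts whose amount in coordinate `b` depends on the
coordinates before `b`. -/
theorem pi_map_add {E : Type*} [NormedAddCommGroup E] [MeasurableSpace E] [BorelSpace E]
    [SecondCountableTopology E] (hq : 0 < q) :
    ∀ {n : ℕ} (γ : Fin n → Measure E) [∀ b, IsProbabilityMeasure (γ b)] (c : Fin n → ℝ)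
      (K : Fin n → ℝ≥0∞)
      (_ : ∀ b m, ‖m‖ ≤ c b → HolderDominated q (K b) ((γ b).map (· + m)) (γ b))
      (δ : (Fin n → E) → Fin n → E) (_ : Measurable δ) (_ : ∀ ξ b, ‖δ ξ b‖ ≤ c b)
      (_ : ∀ ξ ξ' b, (∀ j < b, ξ j = ξ' j) → δ ξ b = δ ξ' b),
      HolderDominated q (∏ b, K b) ((Measure.pi γ).map fun ξ => ξ + δ ξ) (Measure.pi γ) := by
  intro n
  induction n with
  | zero =>
    intro γ _ c K _ δ hδ _ _ φ hφ
    rw [lintegral_map hφ (by fun_prop)]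
    have e (f : (Fin 0 → E) → ℝ≥0∞) : ∫⁻ x, f x ∂(Measure.pi γ) = f 0 := by
      rw [lintegral_congr (g := fun _ => f 0) fun x => by rw [Subsingleton.elim x 0],
        lintegral_const, measure_univ, mul_one]
    rw [e, e, ← ENNReal.rpow_mul, mul_one_div_cancel hq.ne', ENNReal.rpow_one,
      Finset.univ_eq_empty, Finset.prod_empty, one_mul, Subsingleton.elim (0 + δ 0) 0]
  | succ n ih =>
    intro γ _ c K h δ hδ hc hpre φ hφ
    have hcons : Measurable fun z : E × (Fin n → E) => (Fin.cons z.1 z.2 : Fin (n + 1) → E) := by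
      refine measurable_pi_iff.2 fun i => ?_
      refine Fin.cases ?_ (fun i => ?_) i
      · simpa using measurable_fst
      · simp only [Fin.cons_succ]; fun_prop
    have hsplit (ψ : (Fin (n + 1) → E) → ℝ≥0∞) (hψ : Measurable ψ) :
        ∫⁻ ξ, ψ ξ ∂(Measure.pi γ) =
          ∫⁻ x, ∫⁻ y, ψ (Fin.cons x y) ∂(Measure.pi fun b : Fin n => γ b.succ) ∂(γ 0) := by
      have := (measurePreserving_piFinSuccAbove γ 0).symm
      rw [← this.lintegral_comp hψ]
      rw [lintegral_prod _ (by exact (hψ.comp (MeasurableEquiv.measurable _)).aemeasurable)]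
      simp [MeasurableEquiv.piFinSuccAbove, Fin.insertNthEquiv]
    -- No coordinate precedes the first, so its shift is a constant.
    set d0 : E := δ 0 0 with hd0
    have hd (ξ) : δ ξ 0 = d0 := hpre _ _ _ (by simp)
    set δ' : E → (Fin n → E) → Fin n → E := fun x y b => δ (Fin.cons x y) b.succ with hδ'
    have hδ'm : Measurable fun z : E × (Fin n → E) => δ' z.1 z.2 :=
      measurable_pi_iff.2 fun b => (measurable_pi_apply b.succ).comp (hδ.comp hcons)
    have hshift (x y) : (Fin.cons x y : Fin (n + 1) → E) + δ (Fin.cons x y) =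
        Fin.cons (x + d0) (y + δ' x y) := by
      ext b
      refine Fin.cases ?_ (fun b => ?_) b
      · simp [hd]
      · simp [hδ']
    rw [lintegral_map hφ (by fun_prop), hsplit _ (by fun_prop), hsplit _ (by fun_prop)]
    simp_rw [hshift]
    have hin : Measurable fun x => ∫⁻ y, φ (Fin.cons x y) ^ q
        ∂(Measure.pi fun b : Fin n => γ b.succ) :=
      Measurable.lintegral_prod_right'
        (f := fun z : E × (Fin n → E) => φ (Fin.cons z.1 z.2) ^ q) ((hφ.comp hcons).pow_const q)
    have hstep (x : E) : ∫⁻ y, φ (Fin.cons (x + d0) (y + δ' x y))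
          ∂(Measure.pi fun b : Fin n => γ b.succ) ≤
        (∏ b : Fin n, K b.succ) * (∫⁻ y, φ (Fin.cons (x + d0) y) ^ q
          ∂(Measure.pi fun b : Fin n => γ b.succ)) ^ (1 / q) := by
      have hx : Measurable (δ' x) := hδ'm.comp (measurable_prodMk_left (x := x))
      have hφx : Measurable fun y : Fin n → E => φ (Fin.cons (x + d0) y) :=
        hφ.comp (hcons.comp (measurable_prodMk_left (x := x + d0)))
      have := ih (fun b => γ b.succ) (fun b => c b.succ) (fun b => K b.succ)
        (fun b => h b.succ) (δ' x) hx (fun y b => hc _ _)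
        (fun y y' b hyy => hpre _ _ _ fun j => by
          refine Fin.cases (by simp) (fun j hj => ?_) j
          simpa using hyy j (by simpa using hj)) _ hφx
      rwa [lintegral_map hφx (by fun_prop)] at this
    -- The test function is the `L^q` norm of `φ` in the remaining coordinates; its `q`-th power
    -- integrates back to the full integral.
    have h0 := h 0 d0 (hc _ _) _ (hin.pow_const (1 / q))
    rw [lintegral_map (hin.pow_const _) (by fun_prop)] at h0
    simp_rw [← ENNReal.rpow_mul, one_div, inv_mul_cancel₀ hq.ne', ENNReal.rpow_one] at h0
    calc _ ≤ ∫⁻ x, (∏ b : Fin n, K b.succ) * (∫⁻ y, φ (Fin.cons (x + d0) y) ^ q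
          ∂(Measure.pi fun b : Fin n => γ b.succ)) ^ (1 / q) ∂(γ 0) := lintegral_mono hstep
      _ = (∏ b : Fin n, K b.succ) * ∫⁻ x, (∫⁻ y, φ (Fin.cons (x + d0) y) ^ q
          ∂(Measure.pi fun b : Fin n => γ b.succ)) ^ (1 / q) ∂(γ 0) :=
        lintegral_const_mul _ ((hin.comp (by fun_prop : Measurable (· + d0))).pow_const _)
      _ ≤ (∏ b : Fin n, K b.succ) * (K 0 * (∫⁻ x, ∫⁻ y, φ (Fin.cons x y) ^ q
          ∂(Measure.pi fun b : Fin n => γ b.succ) ∂(γ 0)) ^ (1 / q)) := by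
        gcongr
        simpa only [one_div] using h0
      _ = _ := by rw [Fin.prod_univ_succ]; ring

end HolderDominated

/-! ### Shifted Gaussians -/

theorem gaussianReal_map_add_eq_withDensity (m : ℝ) :
    (gaussianReal 0 1).map (· + m) = (gaussianReal 0 1).withDensity
      fun x => ENNReal.ofReal (Real.exp (m * x - m ^ 2 / 2)) := by
  rw [gaussianReal_map_add_const, gaussianReal_of_var_ne_zero _ one_ne_zero,
    gaussianReal_of_var_ne_zero _ one_ne_zero,
    ← withDensity_mul _ (measurable_gaussianPDF _ _) (by fun_prop)]
  congr 1
  ext x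
  simp only [gaussianPDF, Pi.mul_apply]
  rw [← ENNReal.ofReal_mul (gaussianPDFReal_nonneg _ _ _)]
  congr 1
  simp only [gaussianPDFReal, mul_assoc, ← Real.exp_add]
  congr 2
  simp
  ring

/-- Hölder leaves the `L^p` norm of the density; the Gaussian moment generating function at `p * m`
gives its `p`-th power as `exp (p (p - 1) m² / 2)`. -/
theorem holderDominated_gaussianReal_map_add {p q : ℝ} (hpq : p.HolderConjugate q) (m : ℝ) :
    HolderDominated q (ENNReal.ofReal (Real.exp ((p - 1) * (m ^ 2 / 2))))
      ((gaussianReal 0 1).map (· + m)) (gaussianReal 0 1) := by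
  intro φ hφ
  have hw : Measurable fun x : ℝ => ENNReal.ofReal (Real.exp (m * x - m ^ 2 / 2)) := by fun_prop
  rw [gaussianReal_map_add_eq_withDensity, lintegral_withDensity_eq_lintegral_mul _ hw hφ]
  refine (ENNReal.lintegral_mul_le_Lp_mul_Lq _ hpq hw.aemeasurable hφ.aemeasurable).trans_eq ?_
  congr 1
  have e (x : ℝ) : ENNReal.ofReal (Real.exp (m * x - m ^ 2 / 2)) ^ p =
      ENNReal.ofReal (Real.exp (-(p * (m ^ 2 / 2)))) * ENNReal.ofReal (Real.exp ((p * m) * x)) := by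
    rw [ENNReal.ofReal_rpow_of_pos (Real.exp_pos _), ← Real.exp_mul,
      ← ENNReal.ofReal_mul (Real.exp_pos _).le, ← Real.exp_add]
    congr 2; ring
  simp_rw [e]
  rw [lintegral_const_mul _ (by fun_prop), ← ofReal_integral_eq_lintegral_ofReal
    (integrable_exp_mul_gaussianReal _) (Filter.Eventually.of_forall fun _ => (Real.exp_pos _).le)]
  have := congrFun (mgf_fun_id_gaussianReal (μ := 0) (v := 1)) (p * m)
  rw [mgf] at this
  rw [this, ← ENNReal.ofReal_mul (Real.exp_pos _).le, ← Real.exp_add,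
    ENNReal.ofReal_rpow_of_pos (Real.exp_pos _), ← Real.exp_mul]
  congr 2
  have := hpq.pos.ne'
  simp
  field_simp
  ring

theorem holderDominated_pi_gaussianReal_map_add {p q : ℝ} (hpq : p.HolderConjugate q) {d : ℕ}
    (m : Fin d → ℝ) :
    HolderDominated q (ENNReal.ofReal (Real.exp ((p - 1) * ((∑ i, m i ^ 2) / 2))))
      ((Measure.pi fun _ : Fin d => gaussianReal 0 1).map (· + m))
      (Measure.pi fun _ : Fin d => gaussianReal 0 1) := by
  have hp1 : 0 < p - 1 := by linarith [hpq.lt]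
  have := HolderDominated.pi_map_add hpq.symm.pos (fun _ : Fin d => gaussianReal 0 1)
    (fun i => |m i|) (fun i => ENNReal.ofReal (Real.exp ((p - 1) * (m i ^ 2 / 2))))
    (fun i x hx => (holderDominated_gaussianReal_map_add hpq x).mono (by
      have : x ^ 2 ≤ m i ^ 2 := sq_le_sq.2 hx
      gcongr))
    (fun _ => m) measurable_const (fun _ _ => le_rfl) (fun _ _ _ _ => rfl)
  rwa [← ENNReal.ofReal_prod_of_nonneg (fun _ _ => (Real.exp_pos _).le), ← Real.exp_sum,
    ← Finset.mul_sum, ← Finset.sum_div] at this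

open scoped MatrixOrder in
theorem multivariateGaussian_zero_sq_smul_one {d : ℕ} {σ : ℝ} (hσ : 0 ≤ σ) :
    multivariateGaussian 0 (σ ^ 2 • (1 : Matrix (Fin d) (Fin d) ℝ)) =
      (Measure.pi fun _ : Fin d => gaussianReal 0 1).map fun x => σ • WithLp.toLp 2 x := by
  have hsq : CFC.sqrt (σ ^ 2 • (1 : Matrix (Fin d) (Fin d) ℝ)) = σ • 1 := by
    refine CFC.sqrt_unique ?_ ?_
    · simp [sq, smul_smul]
    · exact smul_nonneg hσ zero_le_one
  rw [multivariateGaussian, hsq, ← map_pi_eq_stdGaussian, Measure.map_map (by fun_prop)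
    (by fun_prop)]
  congr 1
  ext x
  simp

theorem holderDominated_multivariateGaussian_map_add {p q : ℝ} (hpq : p.HolderConjugate q)
    {d : ℕ} {σ : ℝ} (hσ : 0 < σ) (m : EuclideanSpace ℝ (Fin d)) :
    HolderDominated q (ENNReal.ofReal (Real.exp ((p - 1) * ((‖m‖ / σ) ^ 2 / 2))))
      ((multivariateGaussian 0 (σ ^ 2 • (1 : Matrix (Fin d) (Fin d) ℝ))).map (· + m))
      (multivariateGaussian 0 (σ ^ 2 • (1 : Matrix (Fin d) (Fin d) ℝ))) := by
  have h := (holderDominated_pi_gaussianReal_map_add hpq fun i => m i / σ).map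
    (f := fun x => σ • WithLp.toLp 2 x) (by fun_prop)
  rw [multivariateGaussian_zero_sq_smul_one hσ.le]
  have e : (∑ i, (m i / σ) ^ 2) = (‖m‖ / σ) ^ 2 := by
    rw [div_pow, EuclideanSpace.real_norm_sq_eq, Finset.sum_div]
    simp [div_pow]
  rw [e] at h
  rw [Measure.map_map (by fun_prop) (by fun_prop)] at h ⊢
  convert h using 2
  ext x i
  simp
  field_simp

/-! ### Dyadic combinatorics of the tree -/

/-- The interval of steps `(b - 2^v, b]` summarized by the node of the tree with right end `b`,
where `2^v` is the largest power of two dividing `b`. -/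
def nodeBlock (b : ℕ) : Finset ℕ := Finset.Ioc (b - 2 ^ padicValNat 2 b) b

theorem padicValNat_two_pow_mul_add_one (e c : ℕ) :
    padicValNat 2 (2 ^ e * (2 * c + 1)) = e := by
  rw [padicValNat.mul (by positivity) (by omega), padicValNat.prime_pow,
    padicValNat.eq_zero_of_not_dvd (by omega), add_zero]

theorem nodeBlock_two_pow_mul_add_one (e c : ℕ) :
    nodeBlock (2 ^ e * (2 * c + 1)) = Finset.Ioc (2 ^ e * (2 * c)) (2 ^ e * (2 * c + 1)) := by
  rw [nodeBlock, padicValNat_two_pow_mul_add_one]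
  congr 1
  rw [mul_add, mul_one, Nat.add_sub_cancel]

theorem exists_eq_two_pow_padicValNat_mul {b : ℕ} (hb : b ≠ 0) :
    ∃ c, b = 2 ^ padicValNat 2 b * (2 * c + 1) := by
  obtain ⟨e, k, ⟨c, rfl⟩, rfl⟩ := Nat.exists_eq_two_pow_mul_odd hb
  exact ⟨c, by rw [padicValNat_two_pow_mul_add_one]⟩

/-- The loop invariant. Before the test with `2 ^ e`, `k` is a multiple of `2 ^ (e + 1)`, so an
accepted right end `k + 2 ^ e` is an odd multiple of `2 ^ e`: its block is exactly `(k, k + 2 ^ e]`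
and extends the partition of `(0, k]`. -/
theorem treeNode_fold_spec {V : Type*} [AddCommMonoid V] (f : ℕ → V) {t L : ℕ}
    (hL : t < 2 ^ (L + 1)) (m : ℕ) (hm : m ≤ L + 1) (r : ℕ × Finset (ℕ × ℕ))
    (hr : (List.range m).foldl
      (fun (kS : ℕ × Finset (ℕ × ℕ)) (i : ℕ) =>
        if kS.1 + 2 ^ (L - i) ≤ t then
          (kS.1 + 2 ^ (L - i), insert (kS.1 + 1, kS.1 + 2 ^ (L - i)) kS.2)
        else kS) (0, ∅) = r) :
    r.1 ≤ t ∧ t < r.1 + 2 ^ (L + 1 - m) ∧ 2 ^ (L + 1 - m) ∣ r.1 ∧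
      (∀ p ∈ r.2, 1 ≤ p.2 ∧ p.2 ≤ r.1 ∧ p.1 = p.2 - 2 ^ padicValNat 2 p.2 + 1) ∧
      ∑ p ∈ r.2, ∑ j ∈ nodeBlock p.2, f j = ∑ j ∈ Finset.Ioc 0 r.1, f j := by
  induction m generalizing r with
  | zero => subst hr; simpa using hL
  | succ m ih =>
    rw [List.range_succ, List.foldl_append, List.foldl_cons, List.foldl_nil] at hr
    obtain ⟨h1, h2, h3, h4, h5⟩ := ih (by omega) _ rfl
    revert hr h1 h2 h3 h4 h5
    generalize List.foldl _ _ _ = w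
    obtain ⟨k, S⟩ := w
    intro hr h1 h2 h3 h4 h5
    simp only at hr h1 h2 h3 h4 h5
    obtain ⟨e, he⟩ : ∃ e, e = L - m := ⟨_, rfl⟩
    have e1 : L + 1 - m = e + 1 := by omega
    have e2 : L + 1 - (m + 1) = e := by omega
    rw [e1, pow_succ] at h2
    rw [e1] at h3
    rw [← he] at hr
    rw [e2]
    have hpos : 0 < 2 ^ e := by positivity
    obtain ⟨c, hc⟩ := h3
    split_ifs at hr with hk
    · subst hr
      have hb : k + 2 ^ e = 2 ^ e * (2 * c + 1) := by rw [hc]; ring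
      have hk2 : k = 2 ^ e * (2 * c) := by rw [hc]; ring
      refine ⟨hk, by simp only; omega, ⟨2 * c + 1, hb⟩, ?_, ?_⟩
      · intro p hp
        rcases Finset.mem_insert.1 hp with rfl | hp
        · refine ⟨by simp only; omega, le_rfl, ?_⟩
          simp only [hb, padicValNat_two_pow_mul_add_one]
          rw [← hb]; omega
        · obtain ⟨a1, a2, a3⟩ := h4 p hp
          exact ⟨a1, by simp only; omega, a3⟩
      · rw [Finset.sum_insert, h5]
        · simp only
          rw [hb, nodeBlock_two_pow_mul_add_one, ← hb, ← hk2, add_comm (∑ j ∈ _, f j),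
            Finset.sum_Ioc_consecutive _ (Nat.zero_le _) (by omega)]
        · intro hmem
          have := (h4 _ hmem).2.1
          simp only at this
          omega
    · subst hr
      exact ⟨h1, by simp only; omega, ⟨2 * c, by rw [hc]; ring⟩, h4, h5⟩

theorem treeNode_spec {V : Type*} [AddCommMonoid V] (f : ℕ → V) (t : ℕ) :
    (∀ p ∈ treeNode t, 1 ≤ p.2 ∧ p.2 ≤ t ∧ p.1 = p.2 - 2 ^ padicValNat 2 p.2 + 1) ∧
      ∑ p ∈ treeNode t, ∑ j ∈ nodeBlock p.2, f j = ∑ j ∈ Finset.Ioc 0 t, f j := by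
  have hL : t < 2 ^ (Nat.clog 2 t + 1) := by
    have := Nat.le_pow_clog one_lt_two t
    have : 0 < 2 ^ Nat.clog 2 t := by positivity
    rw [pow_succ]; omega
  obtain ⟨h1, h2, -, h4, h5⟩ := treeNode_fold_spec f hL _ le_rfl _ rfl
  rw [Nat.sub_self, pow_zero] at h2
  have hk := le_antisymm h1 (by omega)
  rw [hk] at h4 h5
  exact ⟨h4, h5⟩

theorem le_of_mem_treeNode {a b t : ℕ} (h : (a, b) ∈ treeNode t) : b ≤ t :=
  ((treeNode_spec (fun _ => 0) t).1 _ h).2.1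

open Classical in
/-- The blocks of the nodes of `i` partition the steps up to `i`. -/
theorem sum_treeNode_sum_nodeBlock {V : Type*} [AddCommMonoid V] {n : ℕ} (g : Fin n → V)
    (i : Fin n) :
    ∑ b ∈ Finset.univ.filter
        (fun b : Fin n => ∃ a : ℕ, (a, (b : ℕ) + 1) ∈ treeNode ((i : ℕ) + 1)),
      ∑ j ∈ Finset.univ.filter (fun j : Fin n => (j : ℕ) + 1 ∈ nodeBlock ((b : ℕ) + 1)), g j =
    ∑ j : Fin ((i : ℕ) + 1), g ⟨j, by omega⟩ := by
  have hf (A : Finset ℕ) : ∑ j ∈ A, ∑ k : Fin n, (if (k : ℕ) + 1 = j then g k else 0) =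
      ∑ k ∈ Finset.univ.filter (fun k : Fin n => (k : ℕ) + 1 ∈ A), g k := by
    rw [Finset.sum_comm, Finset.sum_filter]
    refine Finset.sum_congr rfl fun k _ => ?_
    rw [Finset.sum_ite_eq]
  obtain ⟨h1, h2⟩ := treeNode_spec
    (fun j => ∑ k : Fin n, (if (k : ℕ) + 1 = j then g k else 0)) ((i : ℕ) + 1)
  simp_rw [hf] at h2
  refine Eq.trans ?_ (h2.trans ?_)
  · refine Finset.sum_bij
      (fun (b : Fin n) _ => ((b : ℕ) + 1 - 2 ^ padicValNat 2 ((b : ℕ) + 1) + 1, (b : ℕ) + 1))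
      ?_ ?_ ?_ (fun _ _ => rfl)
    · intro b hb
      obtain ⟨a, ha⟩ := (Finset.mem_filter.1 hb).2
      have := (h1 _ ha).2.2
      simp only at this
      rwa [← this]
    · intro b _ b' _ h
      have := (Prod.ext_iff.1 h).2
      exact Fin.ext (by simpa using this)
    · rintro ⟨a, b⟩ hp
      obtain ⟨a1, a2, a3⟩ := h1 _ hp
      simp only at a1 a2 a3
      have hb : b - 1 + 1 = b := by omega
      refine ⟨⟨b - 1, by omega⟩, ?_, ?_⟩
      · simp only [Finset.mem_filter, Finset.mem_univ, true_and]
        exact ⟨a, by rwa [hb]⟩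
      · simp only [hb, a3]
  · refine (Finset.sum_bij (fun (j : Fin ((i : ℕ) + 1)) _ => (⟨j, by omega⟩ : Fin n))
      ?_ ?_ ?_ (fun _ _ => rfl)).symm
    · intro j _
      simp only [Finset.mem_filter, Finset.mem_univ, true_and, Finset.mem_Ioc]
      omega
    · intro j _ j' _ h
      exact Fin.ext (by simpa using h)
    · intro j hj
      simp only [Finset.mem_filter, Finset.mem_univ, true_and, Finset.mem_Ioc] at hj
      exact ⟨⟨j, by omega⟩, Finset.mem_univ _, rfl⟩

/-- Each step lies in at most `⌊log₂ n⌋ + 1` blocks. -/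
theorem card_mem_nodeBlock_le (n j : ℕ) :
    (Finset.univ.filter fun b : Fin n => j ∈ nodeBlock ((b : ℕ) + 1)).card ≤ Nat.log 2 n + 1 := by
  rw [← Finset.card_range (Nat.log 2 n + 1)]
  refine Finset.card_le_card_of_injOn (fun b => padicValNat 2 ((b : ℕ) + 1)) ?_ ?_
  · intro b _
    have h1 : 2 ^ padicValNat 2 ((b : ℕ) + 1) ≤ (b : ℕ) + 1 :=
      Nat.le_of_dvd (by omega) pow_padicValNat_dvd
    have := Nat.le_log_of_pow_le one_lt_two (h1.trans (by omega : (b : ℕ) + 1 ≤ n))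
    simp only [Finset.coe_range, Set.mem_Iio]
    omega
  · intro b hb b' hb' h
    obtain ⟨c, hc⟩ := exists_eq_two_pow_padicValNat_mul (Nat.succ_ne_zero (b : ℕ))
    obtain ⟨c', hc'⟩ := exists_eq_two_pow_padicValNat_mul (Nat.succ_ne_zero (b' : ℕ))
    simp only [Nat.succ_eq_add_one] at hc hc' h
    rw [← h] at hc'
    generalize padicValNat 2 ((b : ℕ) + 1) = e at hc hc'
    have hb := (Finset.mem_filter.1 hb).2
    have hb' := (Finset.mem_filter.1 hb').2
    rw [hc, nodeBlock_two_pow_mul_add_one, Finset.mem_Ioc] at hb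
    rw [hc', nodeBlock_two_pow_mul_add_one, Finset.mem_Ioc] at hb'
    have l1 := Nat.lt_of_mul_lt_mul_left (hb.1.trans_le hb'.2)
    have l2 := Nat.lt_of_mul_lt_mul_left (hb'.1.trans_le hb.2)
    -- Blocks of equal length `2 ^ e` with a common point have the same index, so `b` is determined
    -- by its valuation.
    have : c = c' := by omega
    subst this
    exact Fin.ext (by omega)

/-- With `k = ⌊log₂ n⌋`, the crude bound `2 ln n ≥ 1.386 k` reaches `k + 1` once `k ≥ 3`; smaller
`n` are checked directly through `2³ ≤ 3²` and `2⁹ ≤ 5⁴`. The inequality fails at `n = 1, 2, 4`. -/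
theorem log_two_add_one_le_two_mul_log {n : ℕ} (hn : n = 3 ∨ 5 ≤ n) :
    ((Nat.log 2 n + 1 : ℕ) : ℝ) ≤ 2 * Real.log n := by
  have l2 := Real.log_two_gt_d9
  have key (k : ℕ) (h : (2 : ℝ) ^ k ≤ n) : k * 0.693 ≤ Real.log n := by
    have := Real.log_le_log (by positivity) h
    rw [Real.log_pow] at this
    nlinarith [Nat.cast_nonneg (α := ℝ) k]
  rcases hn with rfl | hn
  · have : Nat.log 2 3 = 1 := by norm_num [Nat.log_eq_iff]
    rw [this]
    have h := Real.log_le_log (by norm_num) (by norm_num : (2 : ℝ) ^ 3 ≤ 3 ^ 2)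
    rw [Real.log_pow, Real.log_pow] at h
    push_cast at h ⊢
    linarith
  · rcases lt_or_ge n 8 with h8 | h8
    · have : Nat.log 2 n = 2 := by rw [Nat.log_eq_iff] <;> omega
      rw [this]
      have h := Real.log_le_log (by norm_num) (by exact_mod_cast hn : (5 : ℝ) ≤ n)
      have h5 := Real.log_le_log (by norm_num) (by norm_num : (2 : ℝ) ^ 9 ≤ 5 ^ 4)
      rw [Real.log_pow, Real.log_pow] at h5
      push_cast at h5 ⊢
      linarith
    · have h3 : 3 ≤ Nat.log 2 n := Nat.le_log_of_pow_le one_lt_two (by simpa using h8)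
      have := key _ (by exact_mod_cast Nat.pow_log_le_self 2 (by omega : n ≠ 0))
      have h3' : (3 : ℝ) ≤ Nat.log 2 n := by exact_mod_cast h3
      push_cast
      linarith

/-! ### The coupling of two runs by a noise shift -/

section TreeOutput

variable {n d : ℕ} {m : Fin n → ℕ} {D : Fin n → Type*} {Ω : Type*}
  (M : (i : Fin n) → (Fin (i : ℕ) → EuclideanSpace ℝ (Fin d)) → (Fin (m i) → D i) → Ω →
    EuclideanSpace ℝ (Fin d))

open Classical in
theorem treeNoise_congr {ξ ξ' : Fin n → EuclideanSpace ℝ (Fin d)} {i : Fin n}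
    (h : ∀ j ≤ i, ξ j = ξ' j) : treeNoise ξ i = treeNoise ξ' i := by
  unfold treeNoise
  refine Finset.sum_congr rfl fun b hb => h b ?_
  obtain ⟨a, ha⟩ := (Finset.mem_filter.1 hb).2
  have := le_of_mem_treeNode ha
  exact Fin.le_def.2 (by omega)

theorem treeNoise_add (ξ ξ' : Fin n → EuclideanSpace ℝ (Fin d)) (i : Fin n) :
    treeNoise (ξ + ξ') i = treeNoise ξ i + treeNoise ξ' i := by
  simp [treeNoise, Finset.sum_add_distrib]

theorem treeOutput_congr (Z : FullDataset m D) (ω : Ω)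
    {ξ ξ' : Fin n → EuclideanSpace ℝ (Fin d)} (i : Fin n) (h : ∀ j ≤ i, ξ j = ξ' j) :
    treeOutput M Z ω ξ i = treeOutput M Z ω ξ' i := by
  induction i using WellFoundedLT.induction with
  | ind i ih =>
    rw [treeOutput, treeOutput, treeNoise_congr h]
    congr 1
    refine Finset.sum_congr rfl fun j _ => ?_
    congr 1
    funext k
    have hk : (⟨k, by omega⟩ : Fin n) < i := Fin.lt_def.2 (by simp only; omega)
    exact ih _ hk fun l hl => h l (hl.trans hk.le)

/-- The difference between the summands number `j` on two datasets, at the outputs on the first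
one. -/
noncomputable def outputDiff (Z Z' : FullDataset m D) (ω : Ω) (ξ : Fin n → EuclideanSpace ℝ (Fin d))
    (j : Fin n) : EuclideanSpace ℝ (Fin d) :=
  M j (fun k => treeOutput M Z ω ξ ⟨k, by omega⟩) (Z j) ω -
    M j (fun k => treeOutput M Z ω ξ ⟨k, by omega⟩) (Z' j) ω

/-- The shift of the noise which turns the outputs on the second dataset into those on the first
one. -/
noncomputable def noiseShift (Z Z' : FullDataset m D) (ω : Ω) (ξ : Fin n → EuclideanSpace ℝ (Fin d))
    (b : Fin n) : EuclideanSpace ℝ (Fin d) :=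
  ∑ j ∈ Finset.univ.filter (fun j : Fin n => (j : ℕ) + 1 ∈ nodeBlock ((b : ℕ) + 1)),
    outputDiff M Z Z' ω ξ j

/-- By induction the earlier outputs agree, so both runs feed the same auxiliary inputs to each `M
j`; the shift of the tree noise then cancels the differences of the summands. -/
theorem treeOutput_add_noiseShift (Z Z' : FullDataset m D) (ω : Ω)
    (ξ : Fin n → EuclideanSpace ℝ (Fin d)) (i : Fin n) :
    treeOutput M Z' ω (ξ + noiseShift M Z Z' ω ξ) i = treeOutput M Z ω ξ i := by
  induction i using WellFoundedLT.induction with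
  | ind i ih =>
    have hs : treeNoise (noiseShift M Z Z' ω ξ) i =
        ∑ j : Fin ((i : ℕ) + 1), outputDiff M Z Z' ω ξ ⟨j, by omega⟩ :=
      sum_treeNode_sum_nodeBlock _ i
    rw [treeOutput, treeOutput, treeNoise_add, hs, ← add_assoc, add_right_comm,
      ← Finset.sum_add_distrib]
    congr 1
    refine Finset.sum_congr rfl fun j _ => ?_
    have hx : (fun k : Fin (j : ℕ) =>
        treeOutput M Z' ω (ξ + noiseShift M Z Z' ω ξ) ⟨k, by omega⟩) =
        fun k : Fin (j : ℕ) => treeOutput M Z ω ξ ⟨k, by omega⟩ :=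
      funext fun k => ih _ (Fin.lt_def.2 (by simp only; omega))
    rw [hx, outputDiff]
    exact add_sub_cancel _ _

/-- The block of `b` ends at `b`, and summand `j` sees only outputs before `j`: hence strict
dependence on the past, as composition demands. -/
theorem noiseShift_congr (Z Z' : FullDataset m D) (ω : Ω)
    {ξ ξ' : Fin n → EuclideanSpace ℝ (Fin d)} {b : Fin n} (h : ∀ j < b, ξ j = ξ' j) :
    noiseShift M Z Z' ω ξ b = noiseShift M Z Z' ω ξ' b := by
  refine Finset.sum_congr rfl fun j hj => ?_
  have hjb := (Finset.mem_Ioc.1 (Finset.mem_filter.1 hj).2).2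
  have hx : (fun k : Fin (j : ℕ) => treeOutput M Z ω ξ ⟨k, by omega⟩) =
      fun k : Fin (j : ℕ) => treeOutput M Z ω ξ' ⟨k, by omega⟩ :=
    funext fun k => treeOutput_congr M Z ω _ fun l hl => h l (by
      have := Fin.le_def.1 hl
      simp only at this
      exact Fin.lt_def.2 (by omega))
  rw [outputDiff, outputDiff, hx]

theorem norm_noiseShift_le {Z Z' : FullDataset m D} {i : Fin n} (hZ : ∀ j ≠ i, Z j = Z' j)
    {r : ℝ} (hr : ∀ x ω, ‖M i x (Z i) ω - M i x (Z' i) ω‖ ≤ r) (ω : Ω)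
    (ξ : Fin n → EuclideanSpace ℝ (Fin d)) (b : Fin n) :
    ‖noiseShift M Z Z' ω ξ b‖ ≤ if (i : ℕ) + 1 ∈ nodeBlock ((b : ℕ) + 1) then r else 0 := by
  have h0 (j : Fin n) (hj : j ≠ i) : outputDiff M Z Z' ω ξ j = 0 := by
    rw [outputDiff, hZ j hj, sub_self]
  have : noiseShift M Z Z' ω ξ b =
      if (i : ℕ) + 1 ∈ nodeBlock ((b : ℕ) + 1) then outputDiff M Z Z' ω ξ i else 0 := by
    rw [noiseShift, Finset.sum_filter]
    refine Finset.sum_eq_single i (fun j _ hj => ?_) (by simp)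
    rw [h0 j hj, ite_self]
  rw [this]
  split_ifs
  · exact hr _ _
  · simp

variable [MeasurableSpace Ω]

theorem measurable_treeOutput
    (hM : ∀ (i : Fin n) (z : Fin (m i) → D i),
      Measurable fun p : (Fin (i : ℕ) → EuclideanSpace ℝ (Fin d)) × Ω => M i p.1 z p.2)
    (Z : FullDataset m D) (i : Fin n) :
    Measurable fun p : Ω × (Fin n → EuclideanSpace ℝ (Fin d)) => treeOutput M Z p.1 p.2 i := by
  induction i using WellFoundedLT.induction with
  | ind i ih =>
    rw [show (fun p : Ω × (Fin n → EuclideanSpace ℝ (Fin d)) => treeOutput M Z p.1 p.2 i) = _ from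
      funext fun p => treeOutput.eq_1 M Z p.1 p.2 i]
    refine Measurable.add (Finset.measurable_sum _ fun j _ => ?_) ?_
    · refine (hM ⟨j, by omega⟩ (Z ⟨j, by omega⟩)).comp
        ((measurable_pi_iff.2 fun k => ?_).prodMk measurable_fst)
      exact ih _ (Fin.lt_def.2 (by have := k.isLt; simp only at this ⊢; omega))
    · unfold treeNoise
      fun_prop

theorem measurable_noiseShift
    (hM : ∀ (i : Fin n) (z : Fin (m i) → D i),
      Measurable fun p : (Fin (i : ℕ) → EuclideanSpace ℝ (Fin d)) × Ω => M i p.1 z p.2)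
    (Z Z' : FullDataset m D) :
    Measurable fun p : Ω × (Fin n → EuclideanSpace ℝ (Fin d)) =>
      noiseShift M Z Z' p.1 p.2 := by
  refine measurable_pi_iff.2 fun b => Finset.measurable_sum _ fun j _ => ?_
  have hx : Measurable fun p : Ω × (Fin n → EuclideanSpace ℝ (Fin d)) =>
      ((fun k : Fin (j : ℕ) => treeOutput M Z p.1 p.2 ⟨k, by omega⟩), p.1) :=
    (measurable_pi_iff.2 fun k => measurable_treeOutput M hM Z _).prodMk measurable_fst
  exact ((hM j (Z j)).comp hx).sub ((hM j (Z' j)).comp hx)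

instance isProbabilityMeasure_noiseLaw (σ : Fin n → ℝ) :
    IsProbabilityMeasure (noiseLaw d σ) := by
  unfold noiseLaw
  infer_instance

/-- Compose the Gaussian bounds for each fixed `ω`, average over `ω`, then push both laws forward by
the output map of `Z'`, which by the coupling also produces the law on `Z`. -/
theorem holderDominated_treeMechanism {p q : ℝ} (hpq : p.HolderConjugate q)
    (P : Measure Ω) [IsProbabilityMeasure P]
    (hM : ∀ (i : Fin n) (z : Fin (m i) → D i),
      Measurable fun p : (Fin (i : ℕ) → EuclideanSpace ℝ (Fin d)) × Ω => M i p.1 z p.2)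
    {σ : Fin n → ℝ} (hσ : ∀ b, 0 < σ b) {Z Z' : FullDataset m D} {c : Fin n → ℝ}
    (hc : ∀ ω ξ b, ‖noiseShift M Z Z' ω ξ b‖ ≤ c b) :
    HolderDominated q (ENNReal.ofReal (Real.exp ((p - 1) * ((∑ b, (c b / σ b) ^ 2) / 2))))
      (treeMechanism P M σ Z) (treeMechanism P M σ Z') := by
  have hp1 : 0 < p - 1 := by linarith [hpq.lt]
  have hshift := measurable_noiseShift M hM Z Z'
  have hout (Z : FullDataset m D) : Measurable
      fun p : Ω × (Fin n → EuclideanSpace ℝ (Fin d)) => treeOutput M Z p.1 p.2 :=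
    measurable_pi_iff.2 (measurable_treeOutput M hM Z)
  have hω (ω : Ω) := HolderDominated.pi_map_add hpq.symm.pos
    (fun b => multivariateGaussian 0 ((σ b) ^ 2 • (1 : Matrix (Fin d) (Fin d) ℝ))) c
    (fun b => ENNReal.ofReal (Real.exp ((p - 1) * ((c b / σ b) ^ 2 / 2))))
    (fun b v hv => (holderDominated_multivariateGaussian_map_add hpq (hσ b) v).mono (by
      have := (hσ b).le
      gcongr))
    (noiseShift M Z Z' ω) (hshift.comp measurable_prodMk_left) (hc ω)
    (fun _ _ _ h => noiseShift_congr M Z Z' ω h)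
  rw [← ENNReal.ofReal_prod_of_nonneg (fun _ _ => (Real.exp_pos _).le), ← Real.exp_sum,
    ← Finset.mul_sum, ← Finset.sum_div] at hω
  have hadd : Measurable fun z : Ω × (Fin n → EuclideanSpace ℝ (Fin d)) =>
      z.2 + noiseShift M Z Z' z.1 z.2 := measurable_snd.add hshift
  have h := HolderDominated.prod_map (P := P) (ν := noiseLaw d σ) hpq.symm.lt.le
    (S := fun z => z.2 + noiseShift M Z Z' z.1 z.2) hadd hω
  replace h := h.map (hout Z')
  rw [Measure.map_map (hout Z') (measurable_fst.prodMk hadd)] at h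
  have e : (fun z : Ω × (Fin n → EuclideanSpace ℝ (Fin d)) => treeOutput M Z z.1 z.2) =
      (fun z => treeOutput M Z' z.1 z.2) ∘ fun z => (z.1, z.2 + noiseShift M Z Z' z.1 z.2) := by
    funext z i
    exact (treeOutput_add_noiseShift M Z Z' z.1 z.2 i).symm
  rw [treeMechanism, e]
  exact h

end TreeOutput

/-! ### The privacy bound -/

theorem mainTheorem2 (n d : ℕ) (hn : n = 3 ∨ 5 ≤ n)
    (m : Fin n → ℕ) (D : Fin n → Type*)
    {Ω : Type*} [MeasurableSpace Ω] (P : Measure Ω) [IsProbabilityMeasure P]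
    (M : (i : Fin n) → (Fin (i : ℕ) → EuclideanSpace ℝ (Fin d)) → (Fin (m i) → D i) → Ω →
      EuclideanSpace ℝ (Fin d))
    (hM : ∀ (i : Fin n) (z : Fin (m i) → D i),
      Measurable fun p : (Fin (i : ℕ) → EuclideanSpace ℝ (Fin d)) × Ω => M i p.1 z p.2)
    (s σ : Fin n → ℝ) (hs : ∀ i, 0 ≤ s i) (hσ : ∀ b, 0 < σ b)
    (hsens : ∀ (i : Fin n) (Z Z' : FullDataset m D), Neighboring Z Z' →
      ∀ (x : Fin (i : ℕ) → EuclideanSpace ℝ (Fin d)) (ω : Ω),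
        ‖M i x (Z i) ω - M i x (Z' i) ω‖ ≤ s i) :
    ∃ ρ : ℝ, 0 ≤ ρ ∧
      ρ ≤ √(2 * Real.log n) * (⨆ p : {p : Fin n × Fin n // p.1 ≤ p.2}, s p.1.1 / σ p.1.2) ∧
      ∀ α : ℝ, 1 < α → IsRDP Neighboring (treeMechanism P M σ) α (α * ρ ^ 2 / 2) := by
  set r := ⨆ p : {p : Fin n × Fin n // p.1 ≤ p.2}, s p.1.1 / σ p.1.2 with hr
  have hr0 : 0 ≤ r := Real.iSup_nonneg fun p => div_nonneg (hs _) (hσ _).le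
  refine ⟨√(2 * Real.log n) * r, by positivity, le_rfl, fun α hα Z Z' hZ => ?_⟩
  obtain ⟨p, -, hp⟩ := id hZ
  have hZ0 (j : Fin n) (hj : j ≠ p.1) : Z j = Z' j := by
    funext k
    by_contra hk
    exact hj (congrArg Sigma.fst (hp ⟨j, k⟩ hk))
  have hpq := Real.HolderConjugate.conjExponent hα
  have hout (Z : FullDataset m D) : Measurable
      fun p : Ω × (Fin n → EuclideanSpace ℝ (Fin d)) => treeOutput M Z p.1 p.2 :=
    measurable_pi_iff.2 (measurable_treeOutput M hM Z)
  have hprob (Z : FullDataset m D) : IsProbabilityMeasure (treeMechanism P M σ Z) :=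
    Measure.isProbabilityMeasure_map (hout Z).aemeasurable
  -- A block containing the changed step has right end `b` no earlier than it, so each nonzero ratio
  -- is one of those in the supremum `r`.
  have hsum : ∑ b : Fin n,
      ((if (p.1 : ℕ) + 1 ∈ nodeBlock ((b : ℕ) + 1) then s p.1 else 0) / σ b) ^ 2 ≤
      (√(2 * Real.log n) * r) ^ 2 := by
    calc _ ≤ ∑ b : Fin n, if (p.1 : ℕ) + 1 ∈ nodeBlock ((b : ℕ) + 1) then r ^ 2 else 0 := by
          refine Finset.sum_le_sum fun b _ => ?_
          split_ifs with hb
          · have hpb : p.1 ≤ b := Fin.le_def.2 (by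
              have := (Finset.mem_Ioc.1 hb).2
              omega)
            have := le_ciSup (f := fun p : {p : Fin n × Fin n // p.1 ≤ p.2} =>
              s p.1.1 / σ p.1.2) (Set.finite_range _).bddAbove ⟨(p.1, b), hpb⟩
            exact pow_le_pow_left₀ (div_nonneg (hs _) (hσ _).le) this 2
          · simp
      _ = ((Finset.univ.filter fun b : Fin n =>
            (p.1 : ℕ) + 1 ∈ nodeBlock ((b : ℕ) + 1)).card : ℝ) * r ^ 2 := by
          rw [← Finset.sum_filter, Finset.sum_const, nsmul_eq_mul]
      _ ≤ (2 * Real.log n) * r ^ 2 := by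
          gcongr
          exact (Nat.cast_le.2 (card_mem_nodeBlock_le n _)).trans
            (log_two_add_one_le_two_mul_log hn)
      _ = (√(2 * Real.log n) * r) ^ 2 := by
          rw [mul_pow, Real.sq_sqrt (mul_nonneg zero_le_two (Real.log_natCast_nonneg n))]
  have h := holderDominated_treeMechanism M hpq P hM hσ
    (norm_noiseShift_le M hZ0 (hsens p.1 Z Z' hZ))
  have hα1 : 0 < α - 1 := by linarith
  rw [mul_div_assoc]
  refine (h.mono (ENNReal.ofReal_le_ofReal (Real.exp_le_exp.2 ?_))).renyiDiv_le hpq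
  gcongr
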